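/- **Theorem.** For an entire function $f$ put $M_f(R)=\max_{|\omega|=R}|f(\omega)|$; the order of $f$ is $\rho_f=\limsup_{R\to\infty}\frac{\ln\ln M_f(R)}{\ln R}$. (a) Let $f$ be an even entire function of order $\rho_f=1$ all of whose zeroes are simple and different from $0$. Write the zero set as $\{\omega_n,-\omega_n\}$, where each pair of opposite zeroes $\pm\omega_n\neq 0$ is listed exactly once, and let $n(R)$ be the number of indices $n$ with $|\omega_n|<R$. Then $n(R)$ is finite for every $R$, and for every $\omega\in\mathbb C$ $$f(\omega)=f(0)\prod_n\Bigl(1-\frac{\omega^2}{\omega_n^2}\Bigr),$$ where the product converges absolutely, i.e. $\sum_n|\omega^2/\omega_n^2|<\infty$. Moreover $$\limsup_{R\to\infty}\frac{\ln n(R)}{\ln R}=1 .$$ (b) Let $\beta>0$, and let $G$ be a meromorphic function on $\mathbb C$ that is holomorphic at every point of $\{\operatorname{Im}\omega\ge 0\}$ and has only simple poles; denote its distinct poles by $\omega_n^+$, and let $n_+(R)$ be the number of poles with $|\omega_n^+|<R$. Put $\rho(\omega)=\frac{G(\omega)-G(-\omega)}{2i}$ and assume that $\omega\rho(\omega)$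 is real and nonnegative for all real $\omega$. Suppose that the thermal product hypothesis holds: after removal of removable singularities, $\sinh(\beta\omega/2)/\rho(\omega)$ is an entire function of order one. Suppose also that, for every nonzero integer $m$, $\rho$ is holomorphic at the Matsubara frequency $2\pi i m/\beta$ and vanishes there. Then there is a real number $\mu>0$, determined by $G'(0)=\frac{i}{2}\mu\beta$, such that for all $\omega$ with neither $\omega$ nor $-\omega$ a pole of $G$ $$\rho(\omega)=\frac{\mu\,\sinh\frac{\beta\omega}{2}}{\prod_n\bigl[1-(\omega/\omega_n^+)^2\bigr]},$$ where $\sum_n|\omega/\omega_n^+|^2<\infty$, so that the product converges absolutely. Moreover, $n_+(R)$ is finite for every $R$, and $$\limsup_{R\to\infty}\frac{\ln n_+(R)}{\ln R}=1 .$$ -/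

import Mathlib

open Filter Topology

noncomputable section

/-- The maximum modulus `M_f(R) = max_{|z| = R} |f z|`. -/
def maxModulus (f : ℂ → ℂ) (R : ℝ) : ℝ :=
  sSup ((fun z : ℂ => ‖f z‖) '' Metric.sphere (0 : ℂ) R)

/-- The order `limsup_{R → ∞} ln ln M_f(R) / ln R` of an entire function `f`, as an extended
real number (it is `⊤` for a function of infinite order). -/
def entireOrder (f : ℂ → ℂ) : EReal :=
  limsup (fun R : ℝ =>
    ((Real.log (Real.log (maxModulus f R)) / Real.log R : ℝ) : EReal)) atTop

/-- The number of indices `n` with `|w n| < R`. -/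
def countingFunction {ι : Type*} (w : ι → ℂ) (R : ℝ) : ℕ :=
  {n : ι | ‖w n‖ < R}.ncard

/-- The growth exponent `limsup_{R → ∞} ln n(R) / ln R` of the counting function. -/
def countingExponent {ι : Type*} (w : ι → ℂ) : EReal :=
  limsup (fun R : ℝ =>
    ((Real.log (countingFunction w R) / Real.log R : ℝ) : EReal)) atTop

/-- `z` is a pole of the (meromorphic) function `G`. -/
def IsPoleOf (G : ℂ → ℂ) (z : ℂ) : Prop := meromorphicOrderAt G z < 0

/-- The spectral function `ρ(z) = (G(z) - G(-z)) / (2i)`. -/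
def spectralFunction (G : ℂ → ℂ) (z : ℂ) : ℂ := (G z - G (-z)) / (2 * Complex.I)

/-- A correlator with simple poles: `G` is meromorphic on `ℂ`, holomorphic at every point that is
not a pole, all its poles are simple, it is holomorphic on the closed upper half-plane, and
`x ρ(x)` is real and nonnegative for real `x`. -/
structure IsStableCorrelator (G : ℂ → ℂ) : Prop where
  meromorphic : ∀ z, MeromorphicAt G z
  analytic_of_not_pole : ∀ z, ¬ IsPoleOf G z → AnalyticAt ℂ G z
  simple_poles : ∀ z, IsPoleOf G z → meromorphicOrderAt G z = -1
  retarded : ∀ z : ℂ, 0 ≤ z.im → AnalyticAt ℂ G z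
  positive : ∀ x : ℝ, ((x : ℂ) * spectralFunction G x).im = 0 ∧
    0 ≤ ((x : ℂ) * spectralFunction G x).re

/-- The thermal product hypothesis: the meromorphic function `sinh(βz/2) / ρ(z)` is (after removal
of removable singularities, which form a discrete closed set) an entire function of order one. -/
def ThermalProductHypothesis (β : ℝ) (G : ℂ → ℂ) : Prop :=
  ∃ F : ℂ → ℂ, Differentiable ℂ F ∧ entireOrder F = 1 ∧
    F =ᶠ[codiscrete ℂ] fun z => Complex.sinh (β * z / 2) / spectralFunction G z

/-- No coincidences at the Matsubara frequencies: at every `2πim/β` with `m` a nonzero integer,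
`ρ` is holomorphic and vanishes (after removal of a removable singularity, if any). -/
def VanishesAtMatsubara (β : ℝ) (G : ℂ → ℂ) : Prop :=
  ∀ m : ℤ, m ≠ 0 →
    0 < meromorphicOrderAt (spectralFunction G) (2 * Real.pi * Complex.I * m / β)

end

/-!
The even function `f` is compared with its finite products `P_R(z) = ∏ (1 - z² / w n²)` over the
zeroes with `‖w n‖ < R`. The quotient `g_R = f / P_R` is entire, has no zeroes in the disc of radius
`R`, and is bounded by `M_f(3R)` on the disc of radius `3R` by the maximum principle, since every
factor has modulus at least `8` on its boundary (`norm_mul_eight_pow_card_le_maxModulus`). So the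
logarithm of `g_R / g_R(0)` has real part at most `ln M_f(3R) - ln ‖f 0‖ = O(R ^ s)` for some
`s < 2`. As `f` and `P_R` are even, this logarithm has zero derivative at the origin, and the
Borel–Carathéodory inequality followed by the Schwarz lemma of order two bounds its modulus by a
multiple of `R ^ (s - 2) ‖z‖²` for `‖z‖ < R / 2` (`exists_norm_le_and_eq_mul_exp`).
Letting `R → ∞` gives `f = f(0) ∏ (1 - z² / w n²)` with no need
for lower bounds of the canonical product (`eq_mul_tprod_one_sub_sq_div_sq`).

The same estimate at the origin is a Jensen-type inequality `8 ^ n(R) ‖f 0‖ ≤ M_f(3R)`, which gives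
`n(R) = O(R ^ s)` for all `s > 1` (`exists_countingFunction_le`), hence the convergence of the
product and the upper bound for the growth exponent. Conversely, `n(R) ≤ R ^ s` with `s < 1` makes
`∑ ‖w n‖ ^ (-t)` converge for `s < t < 1`, and the product then has order at most `t < 1`
(`norm_tprod_one_sub_sq_div_sq_le`).

For the correlator, `F = sinh(βz/2) / ρ` is even, and comparing orders of vanishing shows that its
zeroes are simple and are exactly the poles of `G` and their negatives
(`meromorphicOrderAt_thermalQuotient`): the zeroes of `sinh` are all cancelled by zeroes of `ρ`. The
factorization applies to `F`, and the slope of `F ρ = sinh(βz/2)` at the origin gives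
`1 / F(0) = μ`, which is positive by the positivity of `x ρ(x)` (`exists_pos_hasDerivAt_zero`).
-/

/-! ### Growth of entire functions -/

theorem norm_le_maxModulus {f : ℂ → ℂ} (hf : Differentiable ℂ f) {R : ℝ} (hR : 0 < R) {z : ℂ}
    (hz : ‖z‖ ≤ R) : ‖f z‖ ≤ maxModulus f R := by
  have hb : BddAbove ((fun z : ℂ => ‖f z‖) '' Metric.sphere (0 : ℂ) R) :=
    (isCompact_sphere 0 R).bddAbove_image hf.continuous.norm.continuousOn
  refine Complex.norm_le_of_forall_mem_frontier_norm_le (U := Metric.ball 0 R) Metric.isBounded_ball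
    hf.diffContOnCl (fun y hy => ?_) ?_
  · rw [frontier_ball _ hR.ne'] at hy
    exact le_csSup hb ⟨y, hy, rfl⟩
  · rw [closure_ball _ hR.ne']
    simpa using hz

theorem maxModulus_le {f : ℂ → ℂ} {R C : ℝ} (hR : 0 ≤ R) (h : ∀ z, ‖z‖ = R → ‖f z‖ ≤ C) :
    maxModulus f R ≤ C := by
  refine csSup_le ((NormedSpace.sphere_nonempty.mpr hR).image _) ?_
  rintro _ ⟨z, hz, rfl⟩
  exact h z (by simpa using hz)

/-- An entire function of order less than `s` satisfies `M_f(R) ≤ exp (R ^ s)` for large `R`. -/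
theorem eventually_maxModulus_le_exp_rpow {f : ℂ → ℂ} {s : ℝ} (h : entireOrder f < s) :
    ∀ᶠ R in atTop, maxModulus f R ≤ Real.exp (R ^ s) := by
  filter_upwards [eventually_lt_of_limsup_lt h, eventually_gt_atTop 1] with R hR hR1
  have hlog : 0 < Real.log R := Real.log_pos hR1
  rw [EReal.coe_lt_coe_iff, div_lt_iff₀ hlog] at hR
  have hRs : 0 < R ^ s := Real.rpow_pos_of_pos (by linarith) s
  -- For `M_f(R) ≤ 1` the iterated logarithm carries no information, but the bound is trivial.
  rcases le_or_gt (maxModulus f R) 1 with h1 | h1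
  · exact h1.trans (Real.one_le_exp hRs.le)
  · have hl : 0 < Real.log (maxModulus f R) := Real.log_pos h1
    rw [← Real.log_rpow (by linarith), Real.log_lt_log_iff hl hRs,
      Real.log_lt_iff_lt_exp (by linarith)] at hR
    exact hR.le

theorem tendsto_const_add_mul_log_div_log (C t : ℝ) :
    Tendsto (fun R : ℝ => (((C + t * Real.log R) / Real.log R : ℝ) : EReal)) atTop
      (𝓝 (t : EReal)) := by
  refine (continuous_coe_real_ereal.tendsto t).comp ?_
  have h : Tendsto (fun R : ℝ => C / Real.log R + t) atTop (𝓝 (0 + t)) :=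
    (Real.tendsto_log_atTop.const_div_atTop C).add_const t
  rw [zero_add] at h
  refine h.congr' ?_
  filter_upwards [eventually_gt_atTop 1] with R hR1
  have hlog : 0 < Real.log R := Real.log_pos hR1
  field_simp

/-- The logarithm of a quantity bounded by `C R ^ t` has growth exponent at most `t`. -/
theorem limsup_log_div_log_le {u : ℝ → ℝ} {C t : ℝ} (ht : 0 < t) (hC : 0 < C)
    (h : ∀ᶠ R in atTop, |u R| ≤ C * R ^ t) :
    limsup (fun R : ℝ => ((Real.log (u R) / Real.log R : ℝ) : EReal)) atTop ≤ t := by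
  rw [← (tendsto_const_add_mul_log_div_log (Real.log C) t).limsup_eq]
  refine limsup_le_limsup ?_
  have h1 : ∀ᶠ R : ℝ in atTop, 1 ≤ C * R ^ t :=
    ((tendsto_rpow_atTop ht).const_mul_atTop hC).eventually_ge_atTop 1
  filter_upwards [h, h1, eventually_gt_atTop 1] with R hR hR1 hR2
  have hlog : 0 < Real.log R := Real.log_pos hR2
  rw [EReal.coe_le_coe_iff]
  refine div_le_div_of_nonneg_right ?_ hlog.le
  rw [← Real.log_rpow (by linarith),
    ← Real.log_mul hC.ne' (Real.rpow_pos_of_pos (by linarith) t).ne', ← Real.log_abs]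
  -- Where `u R = 0`, its logarithm is `0`, which `1 ≤ C R ^ t` covers.
  rcases (abs_nonneg (u R)).eq_or_lt with h0 | h0
  · rw [← h0, Real.log_zero]
    exact Real.log_nonneg hR1
  · exact Real.log_le_log h0 hR

/-- A bound `‖f z‖ ≤ A exp (B ‖z‖ ^ t)` forces the order of `f` to be at most `t`. The condition
`f 0 ≠ 0` keeps `ln M_f(R)` bounded below, so that its absolute value is controlled too. -/
theorem entireOrder_le_of_norm_le_exp {f : ℂ → ℂ} (hf : Differentiable ℂ f) (h0 : f 0 ≠ 0)
    {A B t : ℝ} (ht : 0 < t) (hA : 0 < A) (hB : 0 ≤ B)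
    (h : ∀ z, ‖f z‖ ≤ A * Real.exp (B * ‖z‖ ^ t)) :
    entireOrder f ≤ t := by
  refine limsup_log_div_log_le (C := |Real.log A| + B + |Real.log ‖f 0‖| + 1) ht (by positivity) ?_
  filter_upwards [eventually_gt_atTop 1] with R hR
  have hM := maxModulus_le (f := f) (C := A * Real.exp (B * R ^ t)) (by linarith : 0 ≤ R)
    (fun z hz => hz ▸ h z)
  have hm := norm_le_maxModulus hf (by linarith : 0 < R) (z := 0) (by simp; linarith)
  have hpos : 0 < ‖f 0‖ := norm_pos_iff.mpr h0
  have hRt : 1 ≤ R ^ t := Real.one_le_rpow hR.le ht.le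
  have hup := Real.log_le_log (hpos.trans_le hm) hM
  have hlo := Real.log_le_log hpos hm
  rw [Real.log_mul hA.ne' (Real.exp_pos _).ne', Real.log_exp] at hup
  have e1 : |Real.log A| ≤ |Real.log A| * R ^ t := le_mul_of_one_le_right (abs_nonneg _) hRt
  have e2 : |Real.log ‖f 0‖| ≤ |Real.log ‖f 0‖| * R ^ t := le_mul_of_one_le_right (abs_nonneg _) hRt
  have e3 : 0 ≤ B * R ^ t := by positivity
  rw [abs_le]
  constructor
  · nlinarith [neg_abs_le (Real.log ‖f 0‖), abs_nonneg (Real.log A)]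
  · nlinarith [le_abs_self (Real.log A), abs_nonneg (Real.log ‖f 0‖)]

/-! ### Dividing out finitely many pairs of zeroes -/

theorem exists_eq_sub_mul_of_eq_zero {f : ℂ → ℂ} (hf : Differentiable ℂ f) {a : ℂ} (ha : f a = 0) :
    ∃ g : ℂ → ℂ, Differentiable ℂ g ∧ ∀ z, f z = (z - a) * g z := by
  refine ⟨dslope f a, ?_, fun z => ?_⟩
  · rw [← differentiableOn_univ, Complex.differentiableOn_dslope univ_mem]
    exact hf.differentiableOn
  · simpa [ha, eq_comm] using sub_smul_dslope f a z

theorem exists_eq_mul_one_sub_sq_div_sq {f : ℂ → ℂ} (hf : Differentiable ℂ f) {a : ℂ} (ha0 : a ≠ 0)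
    (ha : f a = 0) (ha' : f (-a) = 0) :
    ∃ g : ℂ → ℂ, Differentiable ℂ g ∧ ∀ z, f z = g z * (1 - z ^ 2 / a ^ 2) := by
  obtain ⟨g, hg, hfg⟩ := exists_eq_sub_mul_of_eq_zero hf ha
  have hga : g (-a) = 0 := by
    have h := hfg (-a)
    rw [ha', zero_eq_mul] at h
    refine h.resolve_left fun h2 => ha0 ?_
    linear_combination (-1 / 2 : ℂ) * h2
  obtain ⟨k, hk, hgk⟩ := exists_eq_sub_mul_of_eq_zero hg hga
  refine ⟨fun z => -a ^ 2 * k z, hk.const_mul _, fun z => ?_⟩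
  rw [hfg, hgk]
  field_simp
  ring

theorem exists_eq_mul_prod_one_sub_sq_div_sq {ι : Type*} {f : ℂ → ℂ} (hf : Differentiable ℂ f)
    {w : ι → ℂ} (hw0 : ∀ n, w n ≠ 0) (hw : Function.Injective fun n => w n ^ 2)
    (hz : ∀ n, f (w n) = 0) (hz' : ∀ n, f (-w n) = 0) (T : Finset ι) :
    ∃ g : ℂ → ℂ, Differentiable ℂ g ∧ ∀ z, f z = g z * ∏ n ∈ T, (1 - z ^ 2 / w n ^ 2) := by
  classical
  induction T using Finset.induction_on with
  | empty => exact ⟨f, hf, by simp⟩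
  | insert m T hm ih =>
    obtain ⟨g, hg, hfg⟩ := ih
    have hP : ∏ n ∈ T, (1 - w m ^ 2 / w n ^ 2) ≠ 0 := by
      refine Finset.prod_ne_zero_iff.mpr fun n hn h => hm ?_
      rw [sub_eq_zero, eq_comm, div_eq_one_iff_eq (pow_ne_zero 2 (hw0 n))] at h
      rwa [hw h]
    have h1 : g (w m) = 0 := by simpa [hP] using (hfg (w m)).symm.trans (hz m)
    have h2 : g (-w m) = 0 := by
      have := (hfg (-w m)).symm.trans (hz' m)
      rw [neg_sq] at this
      simpa [hP] using this
    obtain ⟨k, hk, hgk⟩ := exists_eq_mul_one_sub_sq_div_sq hg (hw0 m) h1 h2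
    exact ⟨k, hk, fun z => by rw [hfg, hgk, Finset.prod_insert hm, mul_assoc]⟩

/-- On `‖z‖ = 3 R` every factor `1 - z ^ 2 / a ^ 2` with `‖a‖ ≤ R` has modulus at least `8`. The
maximum principle then bounds the quotient of `f` by `k` such factors by `M_f(3 R) / 8 ^ k`. -/
theorem norm_mul_eight_pow_card_le_maxModulus {ι : Type*} {f g : ℂ → ℂ} (hg : Differentiable ℂ g)
    {w : ι → ℂ} (hw0 : ∀ n, w n ≠ 0) (hf : Differentiable ℂ f) {T : Finset ι}
    (hfg : ∀ z, f z = g z * ∏ n ∈ T, (1 - z ^ 2 / w n ^ 2)) {R : ℝ} (hR : 0 < R)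
    (hT : ∀ n ∈ T, ‖w n‖ ≤ R) {z : ℂ} (hz : ‖z‖ ≤ 3 * R) :
    ‖g z‖ * 8 ^ T.card ≤ maxModulus f (3 * R) := by
  rw [← le_div_iff₀ (by positivity)]
  refine (norm_le_maxModulus hg (by positivity) hz).trans (maxModulus_le (by positivity) ?_)
  intro y hy
  rw [le_div_iff₀ (by positivity)]
  refine le_trans ?_ (norm_le_maxModulus hf (by positivity) hy.le)
  rw [hfg, norm_mul, norm_prod]
  refine mul_le_mul_of_nonneg_left ?_ (norm_nonneg _)
  rw [← Finset.prod_const]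
  refine Finset.prod_le_prod (fun _ _ => by norm_num) fun n hn => ?_
  have hpos : 0 < ‖w n‖ := norm_pos_iff.mpr (hw0 n)
  have h9 : 9 ≤ ‖y ^ 2 / w n ^ 2‖ := by
    rw [norm_div, norm_pow, norm_pow, hy, le_div_iff₀ (by positivity), mul_pow]
    nlinarith [hT n hn]
  have h := norm_sub_norm_le (y ^ 2 / w n ^ 2) 1
  rw [norm_one] at h
  rw [norm_sub_rev]
  linarith

theorem eight_pow_card_mul_norm_le_maxModulus {ι : Type*} {f : ℂ → ℂ} (hf : Differentiable ℂ f)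
    {w : ι → ℂ} (hw0 : ∀ n, w n ≠ 0) (hw : Function.Injective fun n => w n ^ 2)
    (hz : ∀ n, f (w n) = 0) (hz' : ∀ n, f (-w n) = 0) {T : Finset ι} {R : ℝ} (hR : 0 < R)
    (hT : ∀ n ∈ T, ‖w n‖ ≤ R) :
    ‖f 0‖ * 8 ^ T.card ≤ maxModulus f (3 * R) := by
  obtain ⟨g, hg, hfg⟩ := exists_eq_mul_prod_one_sub_sq_div_sq hf hw0 hw hz hz' T
  have h0 : f 0 = g 0 := by simp [hfg 0]
  rw [h0]
  exact norm_mul_eight_pow_card_le_maxModulus hg hw0 hf hfg hR hT (by simp; positivity)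

/-- A nonzero value at the origin and the bound of `eight_pow_card_mul_norm_le_maxModulus` leave
room for finitely many zeroes in each disc only. -/
theorem finite_norm_lt_of_zeros {ι : Type*} {f : ℂ → ℂ} (hf : Differentiable ℂ f) (h0 : f 0 ≠ 0)
    {w : ι → ℂ} (hw0 : ∀ n, w n ≠ 0) (hw : Function.Injective fun n => w n ^ 2)
    (hz : ∀ n, f (w n) = 0) (hz' : ∀ n, f (-w n) = 0) (R : ℝ) :
    {n | ‖w n‖ < R}.Finite := by
  by_contra hinf
  have hR : 0 < R := by
    obtain ⟨n, hn⟩ := Set.Infinite.nonempty hinf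
    exact (norm_nonneg _).trans_lt hn
  have hpos : 0 < ‖f 0‖ := norm_pos_iff.mpr h0
  obtain ⟨k, hk⟩ := pow_unbounded_of_one_lt (maxModulus f (3 * R) / ‖f 0‖)
    (by norm_num : (1 : ℝ) < 8)
  obtain ⟨T, hT, hcard⟩ := Set.Infinite.exists_subset_card_eq hinf k
  have h := eight_pow_card_mul_norm_le_maxModulus hf hw0 hw hz hz' (T := T) hR
    (fun n hn => le_of_lt (hT hn))
  rw [div_lt_iff₀ hpos, ← hcard] at hk
  linarith

/-! ### Logarithms of nonvanishing functions -/

theorem deriv_zero_of_even {f : ℂ → ℂ} (heven : ∀ z, f (-z) = f z) : deriv f 0 = 0 := by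
  have h := deriv_comp_neg f 0
  simp only [heven, neg_zero] at h
  exact self_eq_neg.mp h

theorem exists_eq_mul_exp_of_ne_zero {g : ℂ → ℂ} {R : ℝ} (hR : 0 < R)
    (hg : DifferentiableOn ℂ g (Metric.ball 0 R)) (hne : ∀ z ∈ Metric.ball (0 : ℂ) R, g z ≠ 0) :
    ∃ k : ℂ → ℂ, k 0 = 0 ∧
      (∀ z ∈ Metric.ball (0 : ℂ) R, HasDerivAt k (deriv g z / g z) z) ∧
      ∀ z ∈ Metric.ball (0 : ℂ) R, g z = g 0 * Complex.exp (k z) := by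
  have h0 : (0 : ℂ) ∈ Metric.ball (0 : ℂ) R := Metric.mem_ball_self hR
  have hd : DifferentiableOn ℂ (fun z => deriv g z / g z) (Metric.ball 0 R) :=
    (hg.deriv Metric.isOpen_ball).div hg hne
  obtain ⟨k₀, hk₀⟩ := hd.isExactOn_ball
  refine ⟨fun z => k₀ z - k₀ 0, sub_self _, fun z hz => (hk₀ z hz).sub_const _, fun z hz => ?_⟩
  have hconst : ∀ y ∈ Metric.ball (0 : ℂ) R,
      HasDerivAt (fun y => g y * Complex.exp (-(k₀ y - k₀ 0))) 0 y := by
    intro y hy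
    have hgy : HasDerivAt g (deriv g y) y :=
      ((hg y hy).differentiableAt (Metric.isOpen_ball.mem_nhds hy)).hasDerivAt
    convert! hgy.mul ((hk₀ y hy).sub_const (k₀ 0)).neg.cexp using 1
    have := hne y hy
    simp only [Pi.neg_apply]
    field_simp
    ring
  have h := (convex_ball (0 : ℂ) R).is_const_of_fderivWithin_eq_zero (𝕜 := ℂ)
    (f := fun y => g y * Complex.exp (-(k₀ y - k₀ 0)))
    (fun y hy => (hconst y hy).differentiableAt.differentiableWithinAt)
    (fun y hy => by
      rw [fderivWithin_of_isOpen Metric.isOpen_ball hy]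
      ext
      simpa using (hconst y hy).deriv) hz h0
  simp only [sub_self, neg_zero, Complex.exp_zero, mul_one] at h
  rw [← h, mul_assoc, ← Complex.exp_add]
  simp

/-- The Borel–Carathéodory inequality turns the one-sided bound on the logarithm `k` of `g / g 0`
into `‖k‖ ≤ 2 A` on the disc of half the radius. Since `g' 0 = 0`, the function `k` vanishes to
second order at the origin, and the Schwarz lemma of order two applies. -/
theorem exists_norm_le_and_eq_mul_exp {g : ℂ → ℂ} {R A : ℝ} (hA : 0 < A)
    (hg : DifferentiableOn ℂ g (Metric.ball 0 R)) (hne : ∀ z ∈ Metric.ball (0 : ℂ) R, g z ≠ 0)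
    (hg' : deriv g 0 = 0) (hbound : ∀ z ∈ Metric.ball (0 : ℂ) R, ‖g z‖ ≤ ‖g 0‖ * Real.exp A)
    {z : ℂ} (hz : ‖z‖ < R / 2) :
    ∃ h : ℂ, ‖h‖ ≤ 8 * (A / R ^ 2) * ‖z‖ ^ 2 ∧ g z = g 0 * Complex.exp h := by
  have hR : 0 < R := by linarith [norm_nonneg z]
  obtain ⟨k, hk0, hkd, hk⟩ := exists_eq_mul_exp_of_ne_zero hR hg hne
  have h0 : (0 : ℂ) ∈ Metric.ball (0 : ℂ) R := Metric.mem_ball_self hR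
  have hsub : Metric.ball (0 : ℂ) (R / 2) ⊆ Metric.ball 0 R :=
    Metric.ball_subset_ball (by linarith)
  have hdiff : DifferentiableOn ℂ k (Metric.ball 0 R) := fun y hy =>
    (hkd y hy).differentiableAt.differentiableWithinAt
  have hre : Set.MapsTo k (Metric.ball 0 R) {y | y.re ≤ A} := by
    intro y hy
    have h := hbound y hy
    rw [hk y hy, norm_mul, Complex.norm_exp] at h
    exact Real.exp_le_exp.mp (le_of_mul_le_mul_left h (norm_pos_iff.mpr (hne 0 h0)))
  have hmaps : Set.MapsTo k (Metric.ball 0 (R / 2)) (Metric.closedBall (k 0) (2 * A)) := by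
    intro y hy
    have h := Complex.borelCaratheodory_zero hA hdiff hre hR (hsub hy) hk0
    rw [mem_ball_zero_iff] at hy
    rw [hk0, mem_closedBall_zero_iff]
    refine h.trans ?_
    rw [div_le_iff₀ (by linarith)]
    nlinarith
  have hlo : (k · - k 0) =o[𝓝 0] fun y : ℂ => ‖y - 0‖ ^ 1 := by
    have h := (hkd 0 h0).isLittleO
    simp only [hg', zero_div, smul_zero, sub_zero] at h
    simpa using h.norm_right
  have h := Complex.dist_le_mul_div_pow_of_mapsTo_ball_of_isLittleO (hdiff.mono hsub) hmaps hlo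
    (mem_ball_zero_iff.mpr hz)
  refine ⟨k z, ?_, hk z (hsub (mem_ball_zero_iff.mpr hz))⟩
  rw [hk0, dist_zero_right, dist_zero_right, one_add_one_eq_two] at h
  refine h.trans_eq ?_
  field_simp
  ring

/-! ### The factorization of even entire functions of order less than two -/

theorem injective_sq_of_injective_of_ne_neg {ι : Type*} {w : ι → ℂ} (hinj : Function.Injective w)
    (hneg : ∀ m n, w m ≠ -w n) : Function.Injective fun n => w n ^ 2 := fun m n h =>
  (sq_eq_sq_iff_eq_or_eq_neg.mp h).elim (fun h => hinj h) fun h => absurd h (hneg m n)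

/-- The quotient of `f` by the factors of the zeroes in the disc of radius `R` has no zeroes in that
disc and its derivative vanishes at the origin, so that for fixed `z` it equals `f 0` up to the
exponential of a quantity of size `ln M_f(3 R) / R ^ 2`. -/
theorem exists_norm_le_and_eq_mul_exp_mul_prod {ι : Type*} {f : ℂ → ℂ} (hf : Differentiable ℂ f)
    (heven : ∀ z, f (-z) = f z) (hsimple : ∀ z, f z = 0 → deriv f z ≠ 0)
    {w : ι → ℂ} (hw0 : ∀ n, w n ≠ 0) (hw : Function.Injective fun n => w n ^ 2)
    (hzero : ∀ z, f z = 0 ↔ ∃ n, z = w n ∨ z = -w n) {R A : ℝ} (hA : 0 < A)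
    (hM : maxModulus f (3 * R) ≤ ‖f 0‖ * Real.exp A) {T : Finset ι}
    (hT : ∀ n, n ∈ T ↔ ‖w n‖ < R) {z : ℂ} (hz : ‖z‖ < R / 2) :
    ∃ h : ℂ, ‖h‖ ≤ 8 * (A / R ^ 2) * ‖z‖ ^ 2 ∧
      f z = f 0 * Complex.exp h * ∏ n ∈ T, (1 - z ^ 2 / w n ^ 2) := by
  have hR : 0 < R := by linarith [norm_nonneg z]
  obtain ⟨g, hg, hfg⟩ := exists_eq_mul_prod_one_sub_sq_div_sq hf hw0 hw
    (fun n => (hzero _).mpr ⟨n, Or.inl rfl⟩) (fun n => (hzero _).mpr ⟨n, Or.inr rfl⟩) T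
  set P : ℂ → ℂ := fun z => ∏ n ∈ T, (1 - z ^ 2 / w n ^ 2) with hP
  have hPd : Differentiable ℂ P := by fun_prop
  have hP0 : P 0 = 1 := by simp [hP]
  have hg0 : f 0 = g 0 := by simpa [hP0] using hfg 0
  have hderiv : ∀ y, deriv f y = deriv g y * P y + g y * deriv P y := fun y => by
    rw [show f = g * P from funext hfg, deriv_mul (hg y) (hPd y)]
  have hg' : deriv g 0 = 0 := by
    have h := hderiv 0
    rwa [deriv_zero_of_even heven, deriv_zero_of_even (f := P) (fun y => by simp [hP]), hP0,
      mul_one, mul_zero, add_zero, eq_comm] at h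
  have hne : ∀ y ∈ Metric.ball (0 : ℂ) R, g y ≠ 0 := by
    intro y hy hgy
    have hfy : f y = 0 := by rw [hfg, hgy, zero_mul]
    obtain ⟨n, hn⟩ := (hzero y).mp hfy
    have hsq : y ^ 2 = w n ^ 2 := sq_eq_sq_iff_eq_or_eq_neg.mpr hn
    have hnT : n ∈ T := by
      rw [hT, ← mem_ball_zero_iff]
      rcases hn with rfl | rfl <;> simpa using hy
    have hPy : P y = 0 := Finset.prod_eq_zero hnT (by
      rw [hsq, div_self (pow_ne_zero 2 (hw0 n)), sub_self])
    exact hsimple y hfy (by rw [hderiv, hPy, hgy, mul_zero, zero_mul, add_zero])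
  have hbound : ∀ y ∈ Metric.ball (0 : ℂ) R, ‖g y‖ ≤ ‖g 0‖ * Real.exp A := by
    intro y hy
    rw [← hg0]
    refine le_trans ?_ hM
    refine le_trans ?_ (norm_mul_eight_pow_card_le_maxModulus hg hw0 hf hfg hR
      (fun n hn => ((hT n).mp hn).le) (z := y) ?_)
    · exact le_mul_of_one_le_right (norm_nonneg _) (one_le_pow₀ (by norm_num))
    · rw [mem_ball_zero_iff] at hy
      linarith
  obtain ⟨h, hh, hgz⟩ := exists_norm_le_and_eq_mul_exp hA hg.differentiableOn hne hg' hbound hz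
  exact ⟨h, hh, by rw [hfg, hgz, hg0]⟩

theorem tendsto_rpow_mul_add_div_sq {s : ℝ} (hs : s < 2) (C B : ℝ) :
    Tendsto (fun R : ℝ => (B * R ^ s + C) / R ^ 2) atTop (𝓝 0) := by
  have h1 : Tendsto (fun R : ℝ => B * R ^ (-(2 - s)) + C * (R ^ 2)⁻¹) atTop (𝓝 (B * 0 + C * 0)) :=
    ((tendsto_rpow_neg_atTop (by linarith)).const_mul B).add
      ((tendsto_pow_atTop two_ne_zero).inv_tendsto_atTop.const_mul C)
  rw [mul_zero, mul_zero, add_zero] at h1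
  refine h1.congr' ?_
  filter_upwards [eventually_gt_atTop 0] with R hR
  rw [neg_sub, Real.rpow_sub hR, Real.rpow_two]
  ring

/-- Hadamard factorization for an even entire function with simple zeroes which grows at most like
`exp (R ^ s)`, `s < 2`; as the function is even, no exponential factor occurs. -/
theorem eq_mul_tprod_one_sub_sq_div_sq {ι : Type*} {f : ℂ → ℂ} (hf : Differentiable ℂ f)
    (heven : ∀ z, f (-z) = f z) (h0 : f 0 ≠ 0) (hsimple : ∀ z, f z = 0 → deriv f z ≠ 0)
    {w : ι → ℂ} (hw0 : ∀ n, w n ≠ 0) (hw : Function.Injective fun n => w n ^ 2)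
    (hzero : ∀ z, f z = 0 ↔ ∃ n, z = w n ∨ z = -w n) {s : ℝ} (hs : s < 2)
    (hM : ∀ᶠ R in atTop, maxModulus f R ≤ Real.exp (R ^ s)) {z : ℂ}
    (hmul : Multipliable fun n => 1 - z ^ 2 / w n ^ 2) :
    f z = f 0 * ∏' n, (1 - z ^ 2 / w n ^ 2) := by
  have hfin : ∀ R : ℝ, {n | ‖w n‖ < R}.Finite := finite_norm_lt_of_zeros hf h0 hw0 hw
    (fun n => (hzero _).mpr ⟨n, Or.inl rfl⟩) (fun n => (hzero _).mpr ⟨n, Or.inr rfl⟩)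
  set T : ℝ → Finset ι := fun R => (hfin R).toFinset with hT
  have hTmem : ∀ R n, n ∈ T R ↔ ‖w n‖ < R := fun R n => by simp [hT]
  have hTtop : Tendsto T atTop atTop :=
    tendsto_atTop_finset_of_monotone
      (fun R S hRS n hn => (hTmem S n).mpr (((hTmem R n).mp hn).trans_le hRS))
      fun n => ⟨‖w n‖ + 1, (hTmem _ n).mpr (lt_add_one _)⟩
  have hprod := hmul.hasProd.comp hTtop
  -- `A R` dominates `ln M_f(3 R) - ln ‖f 0‖` and is positive.
  set A : ℝ → ℝ := fun R => 3 ^ s * R ^ s + (|Real.log ‖f 0‖| + 1) with hAdef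
  have hex : ∀ᶠ R in atTop, ∃ h : ℂ, ‖h‖ ≤ 8 * (A R / R ^ 2) * ‖z‖ ^ 2 ∧
      f z = f 0 * Complex.exp h * ∏ n ∈ T R, (1 - z ^ 2 / w n ^ 2) := by
    have h3 : Tendsto (fun R : ℝ => 3 * R) atTop atTop := tendsto_id.const_mul_atTop (by norm_num)
    filter_upwards [h3.eventually hM, eventually_gt_atTop (2 * ‖z‖), eventually_gt_atTop 0]
      with R hMR hRz hR
    have hA : 0 < A R := by positivity
    refine exists_norm_le_and_eq_mul_exp_mul_prod hf heven hsimple hw0 hw hzero hA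
      (hMR.trans ?_) (hTmem R) (by linarith)
    nth_rw 1 [← Real.exp_log (norm_pos_iff.mpr h0)]
    rw [← Real.exp_add, Real.exp_le_exp, Real.mul_rpow (by norm_num) hR.le]
    simp only [hAdef]
    linarith [neg_abs_le (Real.log ‖f 0‖)]
  choose! h hh using fun (R : ℝ) (H : ∃ h : ℂ, ‖h‖ ≤ 8 * (A R / R ^ 2) * ‖z‖ ^ 2 ∧
      f z = f 0 * Complex.exp h * ∏ n ∈ T R, (1 - z ^ 2 / w n ^ 2)) => H
  have hlim : Tendsto h atTop (𝓝 0) := by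
    refine squeeze_zero_norm' (hex.mono fun R hR => (hh R hR).1) ?_
    simpa using ((tendsto_rpow_mul_add_div_sq hs _ _).const_mul 8).mul_const (‖z‖ ^ 2)
  have hlim2 : Tendsto (fun R => f 0 * Complex.exp (h R) * ∏ n ∈ T R, (1 - z ^ 2 / w n ^ 2)) atTop
      (𝓝 (f 0 * Complex.exp 0 * ∏' n, (1 - z ^ 2 / w n ^ 2))) :=
    (((Complex.continuous_exp.tendsto 0).comp hlim).const_mul (f 0)).mul hprod
  rw [Complex.exp_zero, mul_one] at hlim2
  exact tendsto_nhds_unique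
    (tendsto_const_nhds.congr' (hex.mono fun R hR => (hh R hR).2)) hlim2

/-! ### Counting functions and summability -/

/-- If `n(R) ≤ C R ^ s` for large `R`, then the family `‖w n‖ ^ (-t)` is summable for `t > s`: each
`n` is charged to the smallest disc of radius `2 ^ k` containing `w n`, and these discs contribute
at most a geometric series of ratio `2 ^ (s - t)`. -/
theorem summable_rpow_neg_of_countingFunction_le {ι : Type*} {w : ι → ℂ}
    (hfin : ∀ R : ℝ, {n | ‖w n‖ < R}.Finite) {C s t : ℝ} (ht : 0 < t) (hst : s < t)
    (h : ∀ᶠ R in atTop, (countingFunction w R : ℝ) ≤ C * R ^ s) :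
    Summable fun n => ‖w n‖ ^ (-t) := by
  classical
  set q : ℝ := 2 ^ (-t) with hq
  have hq0 : 0 < q := by positivity
  -- A term `q ^ k` for every disc of radius `2 ^ k` and every index counted in it.
  set F : ℕ × ι → ℝ := fun p => if ‖w p.2‖ < 2 ^ p.1 then q ^ p.1 else 0 with hF
  have hFsupp : ∀ k, ∀ n ∉ (hfin (2 ^ k)).toFinset, F (k, n) = 0 := fun k n hn =>
    if_neg (by simpa using hn)
  have htsum : ∀ k, ∑' n, F (k, n) = countingFunction w (2 ^ k) * q ^ k := fun k => by
    rw [tsum_eq_sum (hFsupp k), Finset.sum_congr rfl (g := fun _ => q ^ k), Finset.sum_const,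
      nsmul_eq_mul, countingFunction, Set.ncard_eq_toFinset_card _ (hfin _)]
    exact fun n hn => if_pos (by simpa using hn)
  have hFsum : Summable F := by
    rw [summable_prod_of_nonneg (fun p => by simp only [hF, Pi.zero_apply]; positivity)]
    refine ⟨fun k => summable_of_ne_finset_zero (hFsupp k), ?_⟩
    have hgeom : Summable fun k : ℕ => C * ((2 : ℝ) ^ s * q) ^ k := by
      refine (summable_geometric_of_lt_one (by positivity) ?_).mul_left C
      rw [hq, ← Real.rpow_add (by norm_num)]
      exact Real.rpow_lt_one_of_one_lt_of_neg (by norm_num) (by linarith)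
    refine hgeom.of_norm_bounded_eventually_nat ?_
    filter_upwards [(tendsto_pow_atTop_atTop_of_one_lt (one_lt_two (α := ℝ))).eventually h]
      with k hk
    rw [htsum, Real.norm_of_nonneg (by positivity), mul_pow, ← mul_assoc]
    refine mul_le_mul_of_nonneg_right (hk.trans_eq ?_) (by positivity)
    rw [← Real.rpow_natCast, ← Real.rpow_mul (by norm_num), mul_comm (k : ℝ),
      Real.rpow_mul (by norm_num), Real.rpow_natCast]
  choose! k hk using fun (n : ι) (hn : 1 ≤ ‖w n‖) => exists_nat_pow_near hn (one_lt_two (α := ℝ))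
  have hcomp : Summable fun n => F (k n + 1, n) :=
    hFsum.comp_injective (i := fun n => (k n + 1, n)) fun m n hmn => (Prod.ext_iff.mp hmn).2
  refine (hcomp.mul_left q⁻¹).of_norm_bounded_eventually ?_
  filter_upwards [(hfin 1).compl_mem_cofinite] with n hn
  obtain ⟨hk1, hk2⟩ := hk n (not_lt.mp hn)
  have hFn : F (k n + 1, n) = q ^ (k n + 1) := if_pos hk2
  rw [hFn, pow_succ', inv_mul_cancel_left₀ hq0.ne', Real.norm_of_nonneg (by positivity), hq,
    ← Real.rpow_natCast, ← Real.rpow_mul (by norm_num), mul_comm (-t), Real.rpow_mul (by norm_num),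
    Real.rpow_natCast]
  exact Real.rpow_le_rpow_of_nonpos (by positivity) hk1 (by linarith)

theorem summable_norm_sq_div_sq {ι : Type*} {w : ι → ℂ} (h : Summable fun n => ‖w n‖ ^ (-2 : ℝ))
    (z : ℂ) : Summable fun n => ‖z ^ 2 / w n ^ 2‖ := by
  refine (h.mul_left (‖z‖ ^ 2)).congr fun n => ?_
  rw [Real.rpow_neg (norm_nonneg _), Real.rpow_two, norm_div, norm_pow, norm_pow, div_eq_mul_inv]

theorem multipliable_one_sub_sq_div_sq {ι : Type*} {w : ι → ℂ} {z : ℂ}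
    (h : Summable fun n => ‖z ^ 2 / w n ^ 2‖) : Multipliable fun n => 1 - z ^ 2 / w n ^ 2 := by
  simpa [sub_eq_add_neg] using Complex.multipliable_one_add_of_summable h.of_norm.neg

/-- Jensen-type bound: the zeroes of an entire function growing at most like `exp (R ^ s)` satisfy
`n(R) = O(R ^ s)`. -/
theorem exists_countingFunction_le {ι : Type*} {f : ℂ → ℂ} (hf : Differentiable ℂ f) (h0 : f 0 ≠ 0)
    {w : ι → ℂ} (hw0 : ∀ n, w n ≠ 0) (hw : Function.Injective fun n => w n ^ 2)
    (hz : ∀ n, f (w n) = 0) (hz' : ∀ n, f (-w n) = 0) {s : ℝ} (hs : 0 < s)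
    (hM : ∀ᶠ R in atTop, maxModulus f R ≤ Real.exp (R ^ s)) :
    ∃ C > 0, ∀ᶠ R in atTop, (countingFunction w R : ℝ) ≤ C * R ^ s := by
  refine ⟨3 ^ s + |Real.log ‖f 0‖|, by positivity, ?_⟩
  have h3 : Tendsto (fun R : ℝ => 3 * R) atTop atTop := tendsto_id.const_mul_atTop (by norm_num)
  filter_upwards [h3.eventually hM, eventually_gt_atTop 1] with R hMR hR
  have hfin := finite_norm_lt_of_zeros hf h0 hw0 hw hz hz' R
  have hpos : 0 < ‖f 0‖ := norm_pos_iff.mpr h0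
  have h := (eight_pow_card_mul_norm_le_maxModulus hf hw0 hw hz hz' (T := hfin.toFinset)
    (by linarith : 0 < R) (fun n hn => le_of_lt (by simpa using hn))).trans hMR
  rw [← Set.ncard_eq_toFinset_card _ hfin] at h
  have h' := Real.log_le_log (by positivity) h
  rw [Real.log_exp, Real.log_mul hpos.ne' (by positivity), Real.log_pow,
    Real.mul_rpow (by norm_num) (by linarith)] at h'
  have h8 : 1 ≤ Real.log 8 := by
    rw [Real.le_log_iff_exp_le (by norm_num)]
    linarith [Real.exp_one_lt_d9]
  have hn := le_mul_of_one_le_right (Nat.cast_nonneg (α := ℝ) {n | ‖w n‖ < R}.ncard) h8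
  have hlog := le_mul_of_one_le_right (abs_nonneg (Real.log ‖f 0‖)) (Real.one_le_rpow hR.le hs.le)
  change (({n | ‖w n‖ < R}.ncard : ℕ) : ℝ) ≤ _
  linarith [neg_abs_le (Real.log ‖f 0‖)]

theorem one_add_sq_le_exp_rpow {x t : ℝ} (hx : 0 ≤ x) (ht : 0 < t) (ht1 : t ≤ 1) :
    1 + x ^ 2 ≤ Real.exp (2 / t * x ^ t) := by
  have h1 : (1 + x ^ 2) ^ (t / 2) ≤ Real.exp (x ^ t) := by
    calc (1 + x ^ 2) ^ (t / 2) ≤ 1 ^ (t / 2) + (x ^ 2) ^ (t / 2) :=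
          Real.rpow_add_le_add_rpow zero_le_one (by positivity) (by positivity) (by linarith)
      _ = x ^ t + 1 := by
          rw [Real.one_rpow, ← Real.rpow_two, ← Real.rpow_mul hx, add_comm]
          congr 2
          ring
      _ ≤ Real.exp (x ^ t) := Real.add_one_le_exp _
  have h2 := Real.rpow_le_rpow (by positivity) h1 (by positivity : 0 ≤ 2 / t)
  rwa [← Real.rpow_mul (by positivity), ← Real.exp_mul, show t / 2 * (2 / t) = 1 by field_simp,
    Real.rpow_one, mul_comm (x ^ t)] at h2

/-- An even canonical product whose zeroes satisfy `∑ ‖w n‖ ^ (-t) < ∞`, with `t ≤ 1`, grows at most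
like the exponential of a multiple of `‖z‖ ^ t`. -/
theorem norm_tprod_one_sub_sq_div_sq_le {ι : Type*} {w : ι → ℂ} {t : ℝ}
    (ht : 0 < t) (ht1 : t ≤ 1) (h : Summable fun n => ‖w n‖ ^ (-t)) {z : ℂ}
    (hmul : Multipliable fun n => 1 - z ^ 2 / w n ^ 2) :
    ‖∏' n, (1 - z ^ 2 / w n ^ 2)‖ ≤ Real.exp (2 / t * (∑' n, ‖w n‖ ^ (-t)) * ‖z‖ ^ t) := by
  refine le_of_tendsto hmul.hasProd.norm (Eventually.of_forall fun T => ?_)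
  have hfac : ∀ n, ‖1 - z ^ 2 / w n ^ 2‖ ≤ Real.exp (2 / t * ‖w n‖ ^ (-t) * ‖z‖ ^ t) := by
    intro n
    have h1 := one_add_sq_le_exp_rpow (x := ‖z‖ / ‖w n‖) (by positivity) ht ht1
    rw [Real.div_rpow (norm_nonneg _) (norm_nonneg _)] at h1
    refine (norm_sub_le _ _).trans (le_trans (le_of_eq ?_) (h1.trans (le_of_eq ?_)))
    · rw [norm_one, ← div_pow, norm_pow, norm_div]
    · rw [Real.rpow_neg (norm_nonneg _), div_eq_mul_inv (‖z‖ ^ t), mul_comm (‖z‖ ^ t), mul_assoc]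
  calc ∏ n ∈ T, ‖1 - z ^ 2 / w n ^ 2‖ ≤ ∏ n ∈ T, Real.exp (2 / t * ‖w n‖ ^ (-t) * ‖z‖ ^ t) :=
        Finset.prod_le_prod (fun _ _ => norm_nonneg _) fun n _ => hfac n
    _ = Real.exp (2 / t * (∑ n ∈ T, ‖w n‖ ^ (-t)) * ‖z‖ ^ t) := by
        rw [← Real.exp_sum, Finset.mul_sum, Finset.sum_mul]
    _ ≤ Real.exp (2 / t * (∑' n, ‖w n‖ ^ (-t)) * ‖z‖ ^ t) := by
        rw [Real.exp_le_exp]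
        gcongr
        exact h.sum_le_tsum T fun n _ => by positivity

/-- The factorization over the zeroes of an even entire function of order one with simple zeroes,
together with the growth of their number. -/
theorem even_entire_order_one_factorization {ι : Type*} {f : ℂ → ℂ} {w : ι → ℂ}
    (hf : Differentiable ℂ f) (heven : ∀ z, f (-z) = f z) (hord : entireOrder f = 1)
    (hsimple : ∀ z, f z = 0 → deriv f z ≠ 0) (hw0 : ∀ n, w n ≠ 0) (hinj : Function.Injective w)
    (hneg : ∀ m n, w m ≠ -w n) (hzero : ∀ z, f z = 0 ↔ ∃ n, z = w n ∨ z = -w n) :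
    (∀ z, Summable fun n => ‖z ^ 2 / w n ^ 2‖) ∧
      (∀ z, Multipliable (fun n => 1 - z ^ 2 / w n ^ 2) ∧
        f z = f 0 * ∏' n, (1 - z ^ 2 / w n ^ 2)) ∧
      (∀ R : ℝ, {n | ‖w n‖ < R}.Finite) ∧
      countingExponent w = 1 := by
  have hw := injective_sq_of_injective_of_ne_neg hinj hneg
  have h0 : f 0 ≠ 0 := fun h => by
    obtain ⟨n, hn⟩ := (hzero 0).mp h
    exact hw0 n (by rcases hn with hn | hn <;> simpa [eq_comm] using hn)
  have hz : ∀ n, f (w n) = 0 := fun n => (hzero _).mpr ⟨n, Or.inl rfl⟩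
  have hz' : ∀ n, f (-w n) = 0 := fun n => (hzero _).mpr ⟨n, Or.inr rfl⟩
  have hfin := finite_norm_lt_of_zeros hf h0 hw0 hw hz hz'
  have hM : ∀ s : ℝ, 1 < s → ∀ᶠ R in atTop, maxModulus f R ≤ Real.exp (R ^ s) := fun s hs =>
    eventually_maxModulus_le_exp_rpow (by rw [hord]; exact_mod_cast hs)
  have hcount : ∀ s : ℝ, 1 < s →
      ∃ C > 0, ∀ᶠ R in atTop, (countingFunction w R : ℝ) ≤ C * R ^ s := fun s hs =>
    exists_countingFunction_le hf h0 hw0 hw hz hz' (by linarith) (hM s hs)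
  have hsum : ∀ z, Summable fun n => ‖z ^ 2 / w n ^ 2‖ := by
    obtain ⟨C, -, hC⟩ := hcount (3 / 2) (by norm_num)
    exact summable_norm_sq_div_sq
      (summable_rpow_neg_of_countingFunction_le hfin two_pos (by norm_num) hC)
  have hmul : ∀ z, Multipliable fun n => 1 - z ^ 2 / w n ^ 2 := fun z =>
    multipliable_one_sub_sq_div_sq (hsum z)
  have hprod : ∀ z, f z = f 0 * ∏' n, (1 - z ^ 2 / w n ^ 2) := fun z =>
    eq_mul_tprod_one_sub_sq_div_sq hf heven h0 hsimple hw0 hw hzero (s := 3 / 2) (by norm_num)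
      (hM _ (by norm_num)) (hmul z)
  refine ⟨hsum, fun z => ⟨hmul z, hprod z⟩, hfin, le_antisymm ?_ ?_⟩
  · refine EReal.le_of_forall_lt_iff_le.mp fun s hs => ?_
    have hs1 : 1 < s := by exact_mod_cast hs
    obtain ⟨C, hC0, hC⟩ := hcount s hs1
    refine limsup_log_div_log_le (u := fun R => (countingFunction w R : ℝ)) (by linarith) hC0
      (hC.mono fun R hR => ?_)
    rwa [Nat.abs_cast]
  · -- If the counting exponent were below `1`, the product would have order below `1`.
    by_contra! hlt
    obtain ⟨s, hs, hs1⟩ := EReal.lt_iff_exists_real_btwn.mp hlt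
    replace hs1 : s < 1 := by exact_mod_cast hs1
    obtain ⟨s', hs', hs'1⟩ := exists_between (max_lt hs1 zero_lt_one)
    obtain ⟨t, hst, ht1⟩ := exists_between hs'1
    have ht0 : 0 < t := ((le_max_right s 0).trans_lt hs').trans hst
    have hss' : s < s' := (le_max_left s 0).trans_lt hs'
    have hcnt : ∀ᶠ R in atTop, (countingFunction w R : ℝ) ≤ 1 * R ^ s' := by
      filter_upwards [eventually_lt_of_limsup_lt hs, eventually_gt_atTop 1] with R hR hR1
      have hlog : 0 < Real.log R := Real.log_pos hR1
      rw [EReal.coe_lt_coe_iff, div_lt_iff₀ hlog] at hR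
      rw [one_mul]
      -- `n(R) = 0` has to be treated apart, as its logarithm is `0` too.
      rcases Nat.eq_zero_or_pos (countingFunction w R) with h | h
      · rw [h, Nat.cast_zero]
        positivity
      · rw [Real.le_rpow_iff_log_le (by exact_mod_cast h) (by linarith)]
        nlinarith
    have hsm := summable_rpow_neg_of_countingFunction_le hfin ht0 hst hcnt
    have hle := entireOrder_le_of_norm_le_exp hf h0 ht0 (norm_pos_iff.mpr h0)
      (B := 2 / t * ∑' n, ‖w n‖ ^ (-t))
      (mul_nonneg (by positivity) (tsum_nonneg fun n => by positivity)) (fun z => by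
        rw [hprod z, norm_mul]
        exact mul_le_mul_of_nonneg_left
          (norm_tprod_one_sub_sq_div_sq_le ht0 ht1.le hsm (hmul z)) (norm_nonneg _))
    rw [hord] at hle
    exact absurd hle (not_le.mpr (by exact_mod_cast ht1))

/-! ### Orders of analytic and meromorphic functions -/

theorem meromorphicOrderAt_eq_zero_iff_ne_zero {f : ℂ → ℂ} {z : ℂ} (hf : AnalyticAt ℂ f z) :
    meromorphicOrderAt f z = 0 ↔ f z ≠ 0 := by
  rw [hf.meromorphicOrderAt_eq, ENat.map_natCast_eq_zero, hf.analyticOrderAt_eq_zero]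

theorem deriv_ne_zero_of_meromorphicOrderAt_eq_one {f : ℂ → ℂ} {z : ℂ} (hf : AnalyticAt ℂ f z)
    (h : meromorphicOrderAt f z = 1) : deriv f z ≠ 0 := by
  have h1 := meromorphicOrderAt_deriv_eq_sub_one (f := f) (x := z) (n := 1) (by simp)
    (by exact_mod_cast h)
  rw [sub_self, WithTop.coe_zero] at h1
  exact (meromorphicOrderAt_eq_zero_iff_ne_zero hf.deriv).mp h1

theorem meromorphicOrderAt_eq_one_of_deriv_ne_zero {f : ℂ → ℂ} {z : ℂ} (hf : AnalyticAt ℂ f z)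
    (h0 : f z = 0) (h : deriv f z ≠ 0) : meromorphicOrderAt f z = 1 := by
  have h1 := hf.analyticOrderAt_sub_eq_one_of_deriv_ne_zero h
  simp only [h0, sub_zero] at h1
  rw [hf.meromorphicOrderAt_eq, h1]
  rfl

theorem tendsto_neg_nhdsNE_neg (z : ℂ) : Tendsto (fun y : ℂ => -y) (𝓝[≠] z) (𝓝[≠] (-z)) :=
  tendsto_nhdsWithin_iff.mpr ⟨(continuous_neg.tendsto z).mono_left nhdsWithin_le_nhds, by
    filter_upwards [self_mem_nhdsWithin] with y hy
    simpa using hy⟩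

theorem entireOrder_ne_one_of_eq_zero {f : ℂ → ℂ} (h : ∀ z, f z = 0) : entireOrder f ≠ 1 := by
  have hM : ∀ᶠ R : ℝ in atTop, |Real.log (maxModulus f R)| ≤ 1 * R ^ (1 / 2 : ℝ) := by
    filter_upwards [eventually_gt_atTop 0] with R hR
    have h0 : maxModulus f R = 0 := le_antisymm (maxModulus_le hR.le fun z _ => by simp [h])
      ((norm_nonneg _).trans (norm_le_maxModulus
        (by rw [funext h]; exact differentiable_const 0) hR (z := 0) (by simpa using hR.le)))
    rw [h0, Real.log_zero, abs_zero]
    positivity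
  intro h1
  have h2 := limsup_log_div_log_le (by norm_num) one_pos hM
  rw [entireOrder] at h1
  rw [h1] at h2
  exact absurd h2 (not_le.mpr (by exact_mod_cast (by norm_num : (1 / 2 : ℝ) < 1)))

/-! ### The thermal factor -/

theorem sinh_mul_div_two_eq_zero {β : ℝ} (hβ : β ≠ 0) {z : ℂ}
    (h : Complex.sinh (β * z / 2) = 0) : ∃ m : ℤ, z = 2 * Real.pi * Complex.I * m / β := by
  have hβ' : (β : ℂ) ≠ 0 := Complex.ofReal_ne_zero.mpr hβ
  have h1 : Complex.sin (-(β * z / 2) * Complex.I) = 0 := by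
    have := Complex.sinh_mul_I (x := -(β * z / 2) * Complex.I)
    rw [mul_assoc, Complex.I_mul_I, mul_neg_one, neg_neg, h] at this
    simpa using this.symm
  obtain ⟨k, hk⟩ := Complex.sin_eq_zero_iff.mp h1
  refine ⟨k, ?_⟩
  rw [eq_div_iff hβ']
  linear_combination 2 * Complex.I * hk + (β * z) * Complex.I_mul_I

theorem hasDerivAt_sinh_mul_div_two (β : ℝ) (z : ℂ) :
    HasDerivAt (fun z : ℂ => Complex.sinh (β * z / 2)) (Complex.cosh (β * z / 2) * (β / 2)) z := by
  have h : HasDerivAt (fun z : ℂ => (β : ℂ) * z / 2) (β / 2) z := by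
    simpa using ((hasDerivAt_id z).const_mul (β : ℂ)).div_const 2
  exact h.csinh

theorem analyticAt_sinh_mul_div_two (β : ℝ) (z : ℂ) :
    AnalyticAt ℂ (fun z : ℂ => Complex.sinh (β * z / 2)) z :=
  Differentiable.analyticAt (fun y => (hasDerivAt_sinh_mul_div_two β y).differentiableAt) z

theorem meromorphicOrderAt_sinh_mul_div_two {β : ℝ} (hβ : β ≠ 0) {z : ℂ}
    (h : Complex.sinh (β * z / 2) = 0) :
    meromorphicOrderAt (fun z : ℂ => Complex.sinh (β * z / 2)) z = 1 := by
  refine meromorphicOrderAt_eq_one_of_deriv_ne_zero (analyticAt_sinh_mul_div_two β z) h ?_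
  rw [(hasDerivAt_sinh_mul_div_two β z).deriv]
  have hβ' : (β : ℂ) ≠ 0 := Complex.ofReal_ne_zero.mpr hβ
  refine mul_ne_zero (fun hc => ?_) (div_ne_zero hβ' two_ne_zero)
  have := Complex.cosh_sq (β * z / 2)
  simp [h, hc] at this

/-! ### The spectral function -/

theorem spectralFunction_neg (G : ℂ → ℂ) (z : ℂ) :
    spectralFunction G (-z) = -spectralFunction G z := by
  simp only [spectralFunction, neg_neg]
  ring

theorem spectralFunction_zero (G : ℂ → ℂ) : spectralFunction G 0 = 0 := by
  simp [spectralFunction]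

namespace IsStableCorrelator

variable {G : ℂ → ℂ}

theorem im_neg_of_isPoleOf (hG : IsStableCorrelator G) {z : ℂ} (hz : IsPoleOf G z) : z.im < 0 := by
  by_contra! h
  exact absurd (hG.retarded z h).meromorphicOrderAt_nonneg (not_le.mpr hz)

theorem meromorphicAt_comp_neg (hG : IsStableCorrelator G) (z : ℂ) :
    MeromorphicAt (fun y => G (-y)) z :=
  (hG.meromorphic (-z)).comp_analyticAt (by fun_prop)

theorem meromorphicAt_spectralFunction (hG : IsStableCorrelator G) (z : ℂ) :
    MeromorphicAt (spectralFunction G) z :=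
  ((hG.meromorphic z).sub (hG.meromorphicAt_comp_neg z)).div (MeromorphicAt.const _ z)

theorem analyticAt_spectralFunction (hG : IsStableCorrelator G) {z : ℂ} (hz : ¬ IsPoleOf G z)
    (hz' : ¬ IsPoleOf G (-z)) : AnalyticAt ℂ (spectralFunction G) z := by
  have h : AnalyticAt ℂ (fun y => G (-y)) z :=
    (hG.analytic_of_not_pole _ hz').fun_comp (f := fun y : ℂ => -y) (by fun_prop)
  exact ((hG.analytic_of_not_pole z hz).sub h).div analyticAt_const (by simp)

theorem meromorphicOrderAt_spectralFunction_of_isPoleOf (hG : IsStableCorrelator G) {z : ℂ}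
    (hz : IsPoleOf G z) : meromorphicOrderAt (spectralFunction G) z = -1 := by
  have him : 0 ≤ (-z).im := by
    rw [Complex.neg_im]
    linarith [hG.im_neg_of_isPoleOf hz]
  have han : AnalyticAt ℂ (fun y => -G (-y)) z :=
    ((hG.retarded _ him).fun_comp (f := fun y : ℂ => -y) (by fun_prop)).neg
  have hfun : spectralFunction G = (fun _ => (2 * Complex.I)⁻¹) * (G + fun y => -G (-y)) := by
    funext y
    simp only [spectralFunction, Pi.mul_apply, Pi.add_apply]
    ring
  have hlt : meromorphicOrderAt G z < meromorphicOrderAt (fun y => -G (-y)) z :=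
    lt_of_lt_of_le hz han.meromorphicOrderAt_nonneg
  rw [hfun, meromorphicOrderAt_mul_of_ne_zero analyticAt_const (by simp),
    meromorphicOrderAt_add_eq_left_of_lt han.meromorphicAt hlt, hG.simple_poles z hz]

end IsStableCorrelator

theorem meromorphicOrderAt_spectralFunction_neg (G : ℂ → ℂ) (z : ℂ) :
    meromorphicOrderAt (spectralFunction G) (-z) = meromorphicOrderAt (spectralFunction G) z := by
  rw [← meromorphicOrderAt_comp_of_deriv_ne_zero (g := fun y : ℂ => -y) (by fun_prop) (by simp),
    meromorphicOrderAt_neg (f := spectralFunction G)]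
  congr 1
  exact funext (spectralFunction_neg G)

theorem meromorphicOrderAt_spectralFunction_of_pole {G : ℂ → ℂ} (hG : IsStableCorrelator G) {z : ℂ}
    (hz : IsPoleOf G z ∨ IsPoleOf G (-z)) : meromorphicOrderAt (spectralFunction G) z = -1 := by
  rcases hz with hz | hz
  · exact hG.meromorphicOrderAt_spectralFunction_of_isPoleOf hz
  · rw [← meromorphicOrderAt_spectralFunction_neg]
    exact hG.meromorphicOrderAt_spectralFunction_of_isPoleOf hz

/-! ### Zeroes of the thermal quotient -/

section Quotient

variable {β : ℝ} {G F : ℂ → ℂ}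

theorem eventuallyEq_nhdsNE_of_codiscrete {f g : ℂ → ℂ} (h : f =ᶠ[codiscrete ℂ] g) (z : ℂ) :
    f =ᶠ[𝓝[≠] z] g := by
  have := mem_codiscreteWithin_iff_forall_mem_nhdsNE.mp h z (Set.mem_univ z)
  rwa [Set.compl_univ, Set.union_empty] at this

theorem even_of_eventuallyEq_sinh_div (hF : Differentiable ℂ F)
    (hFG : F =ᶠ[codiscrete ℂ] fun z => Complex.sinh (β * z / 2) / spectralFunction G z) (z : ℂ) :
    F (-z) = F z := by
  have h1 := eventuallyEq_nhdsNE_of_codiscrete hFG z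
  have h2 := (tendsto_neg_nhdsNE_neg z).eventually (eventuallyEq_nhdsNE_of_codiscrete hFG (-z))
  have h3 : (fun y => F (-y)) =ᶠ[𝓝[≠] z] F := by
    filter_upwards [h1, h2] with y hy1 hy2
    rw [hy1, hy2, spectralFunction_neg, mul_neg, neg_div, Complex.sinh_neg, neg_div_neg_eq]
  have hc : Continuous F := hF.continuous
  exact ((ContinuousAt.eventuallyEq_nhds_iff_eventuallyEq_nhdsNE (by fun_prop) (by fun_prop)).mp
    h3).eq_of_nhds

theorem meromorphicOrderAt_eq_sinh_sub (hG : IsStableCorrelator G)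
    (hFG : F =ᶠ[codiscrete ℂ] fun z => Complex.sinh (β * z / 2) / spectralFunction G z) (z : ℂ) :
    meromorphicOrderAt F z = meromorphicOrderAt (fun z : ℂ => Complex.sinh (β * z / 2)) z -
      meromorphicOrderAt (spectralFunction G) z := by
  rw [meromorphicOrderAt_congr (eventuallyEq_nhdsNE_of_codiscrete hFG z)]
  exact meromorphicOrderAt_div (analyticAt_sinh_mul_div_two β z).meromorphicAt
    (hG.meromorphicAt_spectralFunction z)

theorem meromorphicOrderAt_ne_top_of_entireOrder_eq_one (hF : Differentiable ℂ F)
    (hord : entireOrder F = 1) (z : ℂ) : meromorphicOrderAt F z ≠ ⊤ := by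
  intro h
  have hz : F =ᶠ[𝓝 z] fun _ => 0 :=
    (ContinuousAt.eventuallyEq_nhds_iff_eventuallyEq_nhdsNE hF.continuous.continuousAt
      continuousAt_const).mp (meromorphicOrderAt_eq_top_iff.mp h)
  have hF0 : F = fun _ => 0 := AnalyticOnNhd.eq_of_eventuallyEq (fun y _ => hF.analyticAt y)
    (fun y _ => analyticAt_const) hz
  exact entireOrder_ne_one_of_eq_zero (fun y => congrFun hF0 y) hord

theorem meromorphicOrderAt_spectralFunction_ne_top (hG : IsStableCorrelator G)
    (hF : Differentiable ℂ F) (hord : entireOrder F = 1)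
    (hFG : F =ᶠ[codiscrete ℂ] fun z => Complex.sinh (β * z / 2) / spectralFunction G z) (z : ℂ) :
    meromorphicOrderAt (spectralFunction G) z ≠ ⊤ := by
  intro h
  refine meromorphicOrderAt_ne_top_of_entireOrder_eq_one hF hord z ?_
  rw [meromorphicOrderAt_eq_sinh_sub hG hFG, h, LinearOrderedAddCommGroupWithTop.sub_top]

/-- Away from the Matsubara frequencies only the poles of `ρ` produce zeroes of `sinh / ρ`; at a
Matsubara frequency, and at the origin, the simple zero of `sinh` is cancelled by that of `ρ`. -/
theorem meromorphicOrderAt_thermalQuotient (hβ : 0 < β) (hG : IsStableCorrelator G)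
    (hV : VanishesAtMatsubara β G) (hF : Differentiable ℂ F) (hord : entireOrder F = 1)
    (hFG : F =ᶠ[codiscrete ℂ] fun z => Complex.sinh (β * z / 2) / spectralFunction G z) (z : ℂ) :
    ((IsPoleOf G z ∨ IsPoleOf G (-z)) → meromorphicOrderAt F z = 1) ∧
      (¬ (IsPoleOf G z ∨ IsPoleOf G (-z)) → meromorphicOrderAt F z = 0) := by
  have hsub := meromorphicOrderAt_eq_sinh_sub hG hFG z
  have hnonneg := (hF.analyticAt z).meromorphicOrderAt_nonneg
  have hρtop := meromorphicOrderAt_spectralFunction_ne_top hG hF hord hFG z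
  have hsinh0 := meromorphicOrderAt_eq_zero_iff_ne_zero (analyticAt_sinh_mul_div_two β z)
  have hsinh1 := meromorphicOrderAt_sinh_mul_div_two hβ.ne' (z := z)
  have hpos : Complex.sinh (β * z / 2) = 0 → 0 < meromorphicOrderAt (spectralFunction G) z := by
    intro h
    obtain ⟨m, rfl⟩ := sinh_mul_div_two_eq_zero hβ.ne' h
    rcases eq_or_ne m 0 with rfl | hm
    · have hnp : ¬ IsPoleOf G 0 := fun h => by simpa using hG.im_neg_of_isPoleOf h
      have han : AnalyticAt ℂ (spectralFunction G) 0 :=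
        hG.analyticAt_spectralFunction hnp (by rwa [neg_zero])
      simp only [Int.cast_zero, mul_zero, zero_div]
      refine lt_of_le_of_ne han.meromorphicOrderAt_nonneg fun h => ?_
      exact (meromorphicOrderAt_eq_zero_iff_ne_zero han).mp h.symm (spectralFunction_zero G)
    · exact hV m hm
  constructor
  · intro hp
    have hρ := meromorphicOrderAt_spectralFunction_of_pole hG hp
    have hS : Complex.sinh (β * z / 2) ≠ 0 := fun h => by
      have := hpos h
      rw [hρ] at this
      exact absurd this (by decide)
    rw [hsub, hsinh0.mpr hS, hρ]
    rfl
  · intro hp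
    rw [not_or] at hp
    have hρ := (hG.analyticAt_spectralFunction hp.1 hp.2).meromorphicOrderAt_nonneg
    obtain ⟨k, hk⟩ := WithTop.ne_top_iff_exists.mp hρtop
    rw [← hk] at hsub hρ hpos
    rw [hsub] at hnonneg ⊢
    by_cases hS : Complex.sinh (β * z / 2) = 0
    · have hk1 : (0 : ℤ) < k := by exact_mod_cast hpos hS
      rw [hsinh1 hS] at hnonneg ⊢
      have hk2 : (0 : ℤ) ≤ 1 - k := by exact_mod_cast hnonneg
      have : k = 1 := by lia
      rw [this]
      rfl
    · have hk1 : (0 : ℤ) ≤ k := by exact_mod_cast hρ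
      rw [hsinh0.mpr hS] at hnonneg ⊢
      have hk2 : (0 : ℤ) ≤ 0 - k := by exact_mod_cast hnonneg
      have : k = 0 := by lia
      rw [this]
      rfl

theorem eventuallyEq_mul_spectralFunction (hG : IsStableCorrelator G)
    (hF : Differentiable ℂ F) (hord : entireOrder F = 1)
    (hFG : F =ᶠ[codiscrete ℂ] fun z => Complex.sinh (β * z / 2) / spectralFunction G z) {z : ℂ}
    (hz : ¬ IsPoleOf G z) (hz' : ¬ IsPoleOf G (-z)) :
    (fun y => F y * spectralFunction G y) =ᶠ[𝓝 z] fun y => Complex.sinh (β * y / 2) := by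
  refine (ContinuousAt.eventuallyEq_nhds_iff_eventuallyEq_nhdsNE
    (hF.continuous.continuousAt.mul (hG.analyticAt_spectralFunction hz hz').continuousAt)
    (analyticAt_sinh_mul_div_two β z).continuousAt).mp ?_
  filter_upwards [eventuallyEq_nhdsNE_of_codiscrete hFG z,
    (meromorphicOrderAt_ne_top_iff_eventually_ne_zero (hG.meromorphicAt_spectralFunction z)).mp
      (meromorphicOrderAt_spectralFunction_ne_top hG hF hord hFG z)] with y hy hne
  rw [Pi.mul_apply, hy, div_mul_cancel₀ _ hne]

theorem hasDerivAt_spectralFunction_zero (hG : IsStableCorrelator G) :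
    HasDerivAt (spectralFunction G) (deriv G 0 / Complex.I) 0 := by
  have h : HasDerivAt G (deriv G 0) 0 :=
    (hG.retarded 0 (by simp)).differentiableAt.hasDerivAt
  have h' : HasDerivAt G (deriv G 0) (-0) := by rwa [neg_zero]
  convert! (h.sub (h'.comp 0 (hasDerivAt_neg (0 : ℂ)))).div_const (2 * Complex.I) using 1
  field_simp
  ring

/-- The slope of `ρ` at the origin is the limit of `x ρ(x) / x ^ 2` along the real axis. -/
theorem deriv_spectralFunction_zero_nonneg (hG : IsStableCorrelator G) {d : ℂ}
    (hd : HasDerivAt (spectralFunction G) d 0) : 0 ≤ d.re ∧ d.im = 0 := by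
  have h : HasDerivAt (fun x : ℝ => spectralFunction G x) d 0 :=
    HasDerivAt.comp_ofReal (z := 0) (by simpa using hd)
  have hlim := hasDerivAt_iff_tendsto_slope_zero.mp h
  have hslope : ∀ x : ℝ, x ≠ 0 →
      x⁻¹ • (spectralFunction G ((0 + x : ℝ) : ℂ) - spectralFunction G ((0 : ℝ) : ℂ)) =
        ((x ^ 2)⁻¹ : ℝ) • ((x : ℂ) * spectralFunction G x) := by
    intro x hx
    have hx' : (x : ℂ) ≠ 0 := Complex.ofReal_ne_zero.mpr hx
    rw [zero_add, Complex.ofReal_zero, spectralFunction_zero, sub_zero, Complex.real_smul,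
      Complex.real_smul]
    push_cast
    field_simp
  constructor
  · refine ge_of_tendsto ((Complex.continuous_re.tendsto d).comp hlim) ?_
    filter_upwards [self_mem_nhdsWithin] with x hx
    rw [Function.comp_apply, hslope x hx, Complex.smul_re]
    exact mul_nonneg (by positivity) (hG.positive x).2
  · refine tendsto_nhds_unique ((Complex.continuous_im.tendsto d).comp hlim)
      (tendsto_const_nhds.congr' ?_)
    filter_upwards [self_mem_nhdsWithin] with x hx
    rw [Function.comp_apply, hslope x hx, Complex.smul_im, (hG.positive x).1, smul_zero]

/-- Comparing slopes at the origin in `F ρ = sinh (β z / 2)` identifies `1 / F 0` with a positive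
real multiple of `ρ' 0`. -/
theorem exists_pos_hasDerivAt_zero (hβ : 0 < β) (hG : IsStableCorrelator G)
    (hF : Differentiable ℂ F) (hord : entireOrder F = 1)
    (hFG : F =ᶠ[codiscrete ℂ] fun z => Complex.sinh (β * z / 2) / spectralFunction G z) :
    ∃ μ : ℝ, 0 < μ ∧ F 0 * μ = 1 ∧ HasDerivAt G (Complex.I / 2 * μ * β) 0 := by
  have hβ' : (β : ℂ) ≠ 0 := Complex.ofReal_ne_zero.mpr hβ.ne'
  have hnp : ¬ IsPoleOf G 0 := fun h => by simpa using hG.im_neg_of_isPoleOf h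
  have hd := hasDerivAt_spectralFunction_zero hG
  obtain ⟨hre, him⟩ := deriv_spectralFunction_zero_nonneg hG hd
  set d : ℂ := deriv G 0 / Complex.I with hd_def
  have hd_real : d = (d.re : ℂ) := Complex.ext (by simp) (by simpa using him)
  have hprod := (hF 0).hasDerivAt.mul hd
  have heq : F 0 * d = β / 2 := by
    have h := (eventuallyEq_mul_spectralFunction hG hF hord hFG hnp (by rwa [neg_zero])).deriv_eq
    rw [(hasDerivAt_sinh_mul_div_two β 0).deriv] at h
    have h2 := hprod.deriv
    rw [spectralFunction_zero, mul_zero, zero_add] at h2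
    rw [← h2]
    refine Eq.trans h ?_
    simp
  have hd0 : d ≠ 0 := fun h => by
    rw [h, mul_zero, eq_comm, div_eq_zero_iff] at heq
    exact heq.elim hβ' two_ne_zero
  have hre0 : d.re ≠ 0 := fun h => hd0 (by rw [hd_real, h, Complex.ofReal_zero])
  refine ⟨2 * d.re / β, by positivity, ?_, ?_⟩
  · push_cast
    rw [← hd_real]
    field_simp
    linear_combination 2 * heq
  · convert! (hG.retarded 0 (by simp)).differentiableAt.hasDerivAt using 1
    push_cast
    rw [← hd_real, hd_def]
    field_simp

end Quotient

theorem mainTheorem4 {ι : Type*} :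
    (∀ (f : ℂ → ℂ) (w : ι → ℂ),
      Differentiable ℂ f → (∀ z, f (-z) = f z) → entireOrder f = 1 →
      -- all zeroes of `f` are simple
      (∀ z, f z = 0 → deriv f z ≠ 0) →
      -- the zeroes are the points `± w n`, all different from each other and from `0`
      (∀ n, w n ≠ 0) → Function.Injective w → (∀ m n, w m ≠ -w n) →
      (∀ z, f z = 0 ↔ ∃ n, z = w n ∨ z = -w n) →
      (∀ z, Summable fun n => ‖z ^ 2 / w n ^ 2‖) ∧
      (∀ z, Multipliable (fun n => 1 - z ^ 2 / w n ^ 2) ∧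
        f z = f 0 * ∏' n, (1 - z ^ 2 / w n ^ 2)) ∧
      (∀ R : ℝ, {n | ‖w n‖ < R}.Finite) ∧
      countingExponent w = 1) ∧
    (∀ (β : ℝ) (G : ℂ → ℂ) (w : ι → ℂ),
      0 < β → IsStableCorrelator G → ThermalProductHypothesis β G → VanishesAtMatsubara β G →
      -- `w` enumerates the poles of `G`
      Function.Injective w → Set.range w = {z | IsPoleOf G z} →
      (∀ z, Summable fun n => ‖(z / w n) ^ 2‖) ∧
      (∃ μ : ℝ, 0 < μ ∧ HasDerivAt G (Complex.I / 2 * μ * β) 0 ∧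
        ∀ z, ¬ IsPoleOf G z → ¬ IsPoleOf G (-z) →
          Multipliable (fun n => 1 - (z / w n) ^ 2) ∧
          spectralFunction G z =
            μ * Complex.sinh (β * z / 2) / ∏' n, (1 - (z / w n) ^ 2)) ∧
      (∀ R : ℝ, {n | ‖w n‖ < R}.Finite) ∧
      countingExponent w = 1) := by
  refine ⟨fun f w hf heven hord hsimple hw0 hinj hneg hzero =>
    even_entire_order_one_factorization hf heven hord hsimple hw0 hinj hneg hzero, ?_⟩
  rintro β G w hβ hG ⟨F, hF, hord, hFG⟩ hV hinj hrange
  have hpole : ∀ z, IsPoleOf G z ↔ ∃ n, w n = z := fun z => by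
    rw [← Set.mem_range, hrange]
    rfl
  have him : ∀ n, (w n).im < 0 := fun n => hG.im_neg_of_isPoleOf ((hpole _).mpr ⟨n, rfl⟩)
  have hw0 : ∀ n, w n ≠ 0 := fun n h => by simpa [h] using him n
  have hneg : ∀ m n, w m ≠ -w n := fun m n h => by
    have := him m
    rw [h, Complex.neg_im] at this
    linarith [him n]
  have horder := meromorphicOrderAt_thermalQuotient hβ hG hV hF hord hFG
  have hFzero : ∀ z, F z = 0 ↔ (IsPoleOf G z ∨ IsPoleOf G (-z)) := fun z => by
    refine ⟨fun h => ?_, fun h => ?_⟩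
    · by_contra hp
      exact (meromorphicOrderAt_eq_zero_iff_ne_zero (hF.analyticAt z)).mp ((horder z).2 hp) h
    · by_contra hne
      have h0 := (meromorphicOrderAt_eq_zero_iff_ne_zero (hF.analyticAt z)).mpr hne
      rw [(horder z).1 h] at h0
      exact one_ne_zero h0
  have hzero : ∀ z, F z = 0 ↔ ∃ n, z = w n ∨ z = -w n := fun z => by
    rw [hFzero, hpole, hpole, ← exists_or]
    refine exists_congr fun n => or_congr eq_comm ?_
    rw [eq_comm, neg_eq_iff_eq_neg]
  obtain ⟨hsum, hfac, hfin, hexp⟩ := even_entire_order_one_factorization hF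
    (even_of_eventuallyEq_sinh_div hF hFG) hord
    (fun z hz => deriv_ne_zero_of_meromorphicOrderAt_eq_one (hF.analyticAt z)
      ((horder z).1 ((hFzero z).mp hz))) hw0 hinj hneg hzero
  obtain ⟨μ, hμ, hμF, hG'⟩ := exists_pos_hasDerivAt_zero hβ hG hF hord hFG
  simp only [div_pow]
  refine ⟨hsum, ⟨μ, hμ, hG', fun z hz hz' => ⟨(hfac z).1, ?_⟩⟩, hfin, hexp⟩
  have hFz : F z ≠ 0 := fun h => ((hFzero z).mp h).elim hz hz'
  have hP : ∏' n, (1 - z ^ 2 / w n ^ 2) ≠ 0 := fun h => hFz (by rw [(hfac z).2, h, mul_zero])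
  have heq := (eventuallyEq_mul_spectralFunction hG hF hord hFG hz hz').eq_of_nhds
  rw [eq_div_iff hP, ← heq, (hfac z).2]
  linear_combination (-spectralFunction G z * ∏' n, (1 - z ^ 2 / w n ^ 2)) * hμF
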